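/- Let $\mathbb K\in\{\mathbb R,\mathbb C\}$. For a Banach space $Z$ over $\mathbb K$ let $S_Z$ be its unit sphere, $Z^*$ its dual, $\mathcal L(Z)$ the space of bounded linear operators on $Z$, $\Pi(Z)=\{(z^*,z)\in S_{Z^*}\times S_Z: z^*(z)=1\}$, $v(T)=\sup\{|z^*(Tz)|:(z^*,z)\in\Pi(Z)\}$ the numerical radius of $T\in\mathcal L(Z)$, and $n(Z)=\inf\{v(T):T\in\mathcal L(Z),\ \|T\|=1\}$ the numerical index of $Z$. If $n(Z)>0$, then $v$ is a norm on $\mathcal L(Z)$ equivalent to the operator norm; $\mathcal L_v(Z)$ denotes $\mathcal L(Z)$ with the norm $v$, and $\mathcal K_v(Z)$ its subspace of compact operators. A closed subspace $J$ of a Banach space $E$ is an M-ideal in $E$ if $E^*=J^*\oplus_1 J^\perp$, that is, if its annihilator $J^\perp$ has a complement $N$ in $E^*$ with $\|f+g\|=\|f\|+\|g\|$ for all $f\in N$, $g\in J^\perp$ (such an $N$ is isometric to $J^*$ by restriction). For an infinite-dimensional Banach space $Z$ and $t\ge 0$ put $$\bar\delta_Z(t)=\inf_{x\in S_Z}\ \sup_{Y}\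 \inf_{y\in Y,\ \|y\|\ge t}\big(\|x+y\|-1\big),\qquad \bar\rho_Z(t)=\sup_{x\in S_Z}\ \inf_{Y}\ \sup_{y\in Y,\ \|y\|\le t}\big(\|x+y\|-1\big),$$ where $Y$ runs over the closed subspaces of $Z$ of finite codimension. Finally, $Z\oplus_\infty Z$ and $Z\oplus_1 Z$ are $Z\times Z$ with the norms $\max\{\|x\|,\|y\|\}$ and $\|x\|+\|y\|$. Let $X$ be an infinite-dimensional Banach space over $\mathbb K$ with $n(X)>0$. 1. If $\mathcal K_v(X\oplus_\infty X)$ is an M-ideal in $\mathcal L_v(X\oplus_\infty X)$, then $$n(X)\le\min\left\{\frac1{1+\bar\delta_X(1)},\ \frac{1+\bar\rho_{X^*}(1)}2\right\}.$$ 2. If $\mathcal K_v(X\oplus_1 X)$ is an M-ideal in $\mathcal L_v(X\oplus_1 X)$, then $$n(X)\le\min\left\{\frac{1+\bar\rho_X(1)}2,\ \frac1{1+\bar\delta_{X^*}(1)}\right\}.$$ -/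

import Mathlib

noncomputable section

/-! ### Numerical radius and numerical index -/

/-- The set `Π(E)` of pairs `(f, x)` of norm-one functionals and norm-one vectors
with `f x = 1`. -/
def statePairs (𝕜 E : Type*) [RCLike 𝕜] [NormedAddCommGroup E] [NormedSpace 𝕜 E] :
    Set (StrongDual 𝕜 E × E) :=
  {p | ‖p.1‖ = 1 ∧ ‖p.2‖ = 1 ∧ p.1 p.2 = 1}

/-- The numerical radius `v(T) = sup {|f (T x)| : (f, x) ∈ Π(E)}`. -/
def numericalRadius {𝕜 E : Type*} [RCLike 𝕜] [NormedAddCommGroup E] [NormedSpace 𝕜 E]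
    (T : E →L[𝕜] E) : ℝ :=
  ⨆ p : statePairs 𝕜 E, ‖p.1.1 (T p.1.2)‖

/-- The numerical index `n(E) = inf {v(T) : ‖T‖ = 1}`. -/
def numericalIndex (𝕜 E : Type*) [RCLike 𝕜] [NormedAddCommGroup E] [NormedSpace 𝕜 E] : ℝ :=
  ⨅ T : {T : E →L[𝕜] E // ‖T‖ = 1}, numericalRadius T.1

theorem norm_apply_le_of_mem_statePairs {𝕜 E : Type*} [RCLike 𝕜] [NormedAddCommGroup E]
    [NormedSpace 𝕜 E] (T : E →L[𝕜] E) (p : statePairs 𝕜 E) : ‖p.1.1 (T p.1.2)‖ ≤ ‖T‖ := by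
  obtain ⟨⟨f, x⟩, hf, hx, -⟩ := p
  have h1 := f.le_opNorm (T x)
  have h2 := T.le_opNorm x
  simp only at hf hx
  rw [hf, one_mul] at h1
  rw [hx, mul_one] at h2
  exact h1.trans h2

theorem bddAbove_numericalRadius {𝕜 E : Type*} [RCLike 𝕜] [NormedAddCommGroup E]
    [NormedSpace 𝕜 E] (T : E →L[𝕜] E) :
    BddAbove (Set.range fun p : statePairs 𝕜 E => ‖p.1.1 (T p.1.2)‖) :=
  ⟨‖T‖, by rintro _ ⟨p, rfl⟩; exact norm_apply_le_of_mem_statePairs T p⟩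

/-- The numerical radius is a seminorm on the space of bounded operators. -/
def numericalRadiusSeminorm (𝕜 E : Type*) [RCLike 𝕜] [NormedAddCommGroup E]
    [NormedSpace 𝕜 E] : Seminorm 𝕜 (E →L[𝕜] E) :=
  Seminorm.of numericalRadius
    (fun S T => by
      refine Real.iSup_le (fun p => ?_) (add_nonneg (Real.iSup_nonneg fun _ => norm_nonneg _)
        (Real.iSup_nonneg fun _ => norm_nonneg _))
      calc ‖p.1.1 ((S + T) p.1.2)‖ ≤ ‖p.1.1 (S p.1.2)‖ + ‖p.1.1 (T p.1.2)‖ := by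
            rw [add_apply, map_add]; exact norm_add_le _ _
        _ ≤ _ := add_le_add (le_ciSup (bddAbove_numericalRadius S) p)
            (le_ciSup (bddAbove_numericalRadius T) p))
    (fun a T => by
      simp only [numericalRadius, smul_apply, map_smul, norm_smul]
      rw [Real.mul_iSup_of_nonneg (norm_nonneg a)])

/-! ### Bounded and compact operators with the numerical radius norm -/

/-- The space `L_v(E)`: bounded linear operators on `E` (a type synonym of `E →L[𝕜] E`),
normed by the numerical radius instead of the operator norm.
In general this is only a seminormed space; it is normed if `0 < numericalIndex 𝕜 E`. -/
def NumRadOp (𝕜 E : Type*) [RCLike 𝕜] [NormedAddCommGroup E] [NormedSpace 𝕜 E] : Type _ :=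
  E →L[𝕜] E

instance NumRadOp.instAddCommGroup (𝕜 E : Type*) [RCLike 𝕜] [NormedAddCommGroup E]
    [NormedSpace 𝕜 E] : AddCommGroup (NumRadOp 𝕜 E) :=
  inferInstanceAs (AddCommGroup (E →L[𝕜] E))

instance NumRadOp.instModule (𝕜 E : Type*) [RCLike 𝕜] [NormedAddCommGroup E]
    [NormedSpace 𝕜 E] : Module 𝕜 (NumRadOp 𝕜 E) :=
  inferInstanceAs (Module 𝕜 (E →L[𝕜] E))

/-- The identity map from `L_v(E)` to the bounded operators on `E`. -/
def NumRadOp.toCLM (𝕜 E : Type*) [RCLike 𝕜] [NormedAddCommGroup E] [NormedSpace 𝕜 E] :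
    NumRadOp 𝕜 E ≃ₗ[𝕜] (E →L[𝕜] E) :=
  LinearEquiv.refl 𝕜 (E →L[𝕜] E)

instance NumRadOp.instSeminormedAddCommGroup (𝕜 E : Type*) [RCLike 𝕜] [NormedAddCommGroup E]
    [NormedSpace 𝕜 E] : SeminormedAddCommGroup (NumRadOp 𝕜 E) :=
  AddGroupSeminorm.toSeminormedAddCommGroup
    ((numericalRadiusSeminorm 𝕜 E).comp (NumRadOp.toCLM 𝕜 E).toLinearMap).toAddGroupSeminorm

theorem NumRadOp.norm_def {𝕜 E : Type*} [RCLike 𝕜] [NormedAddCommGroup E] [NormedSpace 𝕜 E]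
    (T : NumRadOp 𝕜 E) : ‖T‖ = numericalRadius (NumRadOp.toCLM 𝕜 E T) :=
  rfl

instance NumRadOp.instNormedSpace (𝕜 E : Type*) [RCLike 𝕜] [NormedAddCommGroup E]
    [NormedSpace 𝕜 E] : NormedSpace 𝕜 (NumRadOp 𝕜 E) where
  norm_smul_le a T :=
    (map_smul_eq_mul (numericalRadiusSeminorm 𝕜 E) a (NumRadOp.toCLM 𝕜 E T)).le

/-- The subspace `K_v(E)` of compact operators in `L_v(E)`. -/
def numRadCompact (𝕜 E : Type*) [RCLike 𝕜] [NormedAddCommGroup E] [NormedSpace 𝕜 E] :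
    Submodule 𝕜 (NumRadOp 𝕜 E) :=
  (compactOperator (RingHom.id 𝕜) E E).comap (NumRadOp.toCLM 𝕜 E).toLinearMap

/-! ### M-ideals -/

/-- The annihilator `J^⊥` of a subspace `J` of `E` in the dual `E^*`. -/
def dualAnnihil {𝕜 E : Type*} [RCLike 𝕜] [SeminormedAddCommGroup E] [NormedSpace 𝕜 E]
    (J : Submodule 𝕜 E) : Submodule 𝕜 (StrongDual 𝕜 E) where
  carrier := {f | ∀ x ∈ J, f x = 0}
  add_mem' {f g} hf hg x hx := by
    show f x + g x = 0
    rw [hf x hx, hg x hx, add_zero]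
  zero_mem' _ _ := rfl
  smul_mem' c f hf x hx := by
    show c • f x = 0
    rw [hf x hx, smul_zero]

/-- A closed subspace `J` of `E` is an M-ideal if its annihilator `J^⊥` is an `ℓ₁`-summand of the
dual: `E^* = N ⊕₁ J^⊥` for some subspace `N` of `E^*`. Such an `N` is canonically isometric to `J^*`
by restriction of functionals to `J` (as `J^* = E^* ⧸ J^⊥`), so this says `E^* = J^* ⊕₁ J^⊥`. -/
def IsMIdeal {𝕜 E : Type*} [RCLike 𝕜] [SeminormedAddCommGroup E] [NormedSpace 𝕜 E]
    (J : Submodule 𝕜 E) : Prop :=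
  IsClosed (J : Set E) ∧
    ∃ N : Submodule 𝕜 (StrongDual 𝕜 E), IsCompl N (dualAnnihil J) ∧
      ∀ f ∈ N, ∀ g ∈ dualAnnihil J, ‖f + g‖ = ‖f‖ + ‖g‖

/-! ### Asymptotic moduli (of an infinite-dimensional space) -/

/-- The closed subspaces of finite codimension. -/
def FinCodim (𝕜 E : Type*) [RCLike 𝕜] [NormedAddCommGroup E] [NormedSpace 𝕜 E] :
    Set (Submodule 𝕜 E) :=
  {Y | IsClosed (Y : Set E) ∧ FiniteDimensional 𝕜 (E ⧸ Y)}

/-- `δ̄_E(x, t) = sup_Y inf {‖x + y‖ - 1 : y ∈ Y, ‖y‖ ≥ t}`, `Y` closed of finite codimension. -/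
def aucModulusAt (𝕜 : Type*) {E : Type*} [RCLike 𝕜] [NormedAddCommGroup E] [NormedSpace 𝕜 E]
    (x : E) (t : ℝ) : ℝ :=
  ⨆ Y : FinCodim 𝕜 E, ⨅ y : {y : E // y ∈ Y.1 ∧ t ≤ ‖y‖}, (‖x + y.1‖ - 1)

/-- The modulus of asymptotic uniform convexity `δ̄_E(t) = inf {δ̄_E(x, t) : ‖x‖ = 1}`. -/
def aucModulus (𝕜 E : Type*) [RCLike 𝕜] [NormedAddCommGroup E] [NormedSpace 𝕜 E]
    (t : ℝ) : ℝ :=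
  ⨅ x : {x : E // ‖x‖ = 1}, aucModulusAt 𝕜 x.1 t

/-- `ρ̄_E(x, t) = inf_Y sup {‖x + y‖ - 1 : y ∈ Y, ‖y‖ ≤ t}`, `Y` closed of finite codimension. -/
def ausModulusAt (𝕜 : Type*) {E : Type*} [RCLike 𝕜] [NormedAddCommGroup E] [NormedSpace 𝕜 E]
    (x : E) (t : ℝ) : ℝ :=
  ⨅ Y : FinCodim 𝕜 E, ⨆ y : {y : E // y ∈ Y.1 ∧ ‖y‖ ≤ t}, (‖x + y.1‖ - 1)

/-- The modulus of asymptotic uniform smoothness `ρ̄_E(t) = sup {ρ̄_E(x, t) : ‖x‖ = 1}`. -/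
def ausModulus (𝕜 E : Type*) [RCLike 𝕜] [NormedAddCommGroup E] [NormedSpace 𝕜 E]
    (t : ℝ) : ℝ :=
  ⨆ x : {x : E // ‖x‖ = 1}, ausModulusAt 𝕜 x.1 t

end

/-!
Write `n` for the numerical index of `X` and `w ⊗ u` for the rank-one operator `x ↦ w x • u`.

If `J` is an M-ideal in `E`, then for `x` in the unit ball of `E`, `y` in the unit ball of `J` and
`ε > 0` some `k ∈ J` satisfies `‖x ± y - k‖ ≤ 1 + ε` for both signs
(`IsMIdeal.exists_norm_add_sub_le`). Apply this to the compact operators on `X ⊕_∞ X`, with the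
projection `T (x, y) = (x, 0)` and the off-diagonal rank-one operator `S (x, y) = (w₀ y • u, 0)`.
States of `X ⊕_∞ X` of the form `((f, 0), (x, y))` leave `y` free in the unit ball, and the two signs
allow the off-diagonal part of the compact operator to be averaged out. What remains is one compact
operator `K` on `X` such that `I - K + w ⊗ u` has numerical radius at most `1 + ε` for all
functionals `w` in the unit ball simultaneously, whence `n ‖I - K + w ⊗ u‖ ≤ 1 + ε`
(`exists_isCompactOperator_norm_le_of_isMIdeal_prod`). For `X ⊕₁ X` the roles of vectors and
functionals are exchanged: `w` is fixed and `u` runs through the unit ball of `X`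
(`exists_isCompactOperator_norm_le_of_isMIdeal_withLp`).

Thus `‖z - K z ± ‖z‖ u‖ ≤ (1 + ε) ‖z‖ / n` for all `z` in the first case. Every subspace of finite
codimension contains a unit vector `z` with `K z` small, and there `‖u + z‖` is at most about `1 / n`;
this is the bound by the modulus of asymptotic uniform convexity. For the modulus of asymptotic
uniform smoothness of the dual, let `f` be a norm-one functional with `f u = 1`. A subspace of `X^*`
of finite codimension contains a norm-one functional `h` with `h ∘ K` small. If `z` almost norms `h`,
then, with `z' = z - K z`,
`(f + h) (u + z') + (f - h) (u - z') = 2 f u + 2 h z'` is about `4`, while `‖u ± z'‖` is at most about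
`1 / n`; so one of `‖f ± h‖` is at least about `2 n`. The second case is the same with the adjoint
bound `‖h - h ∘ K ± ‖h‖ f‖ ≤ (1 + ε) ‖h‖ / n` on functionals `h`.
-/

/-! ### M-ideals and numerical radii -/

/-- The norm on the dual of a product with the maximum norm dominates the sum of the norms of the
two components. -/
theorem norm_comp_inl_add_norm_comp_inr_le {𝕜 E F : Type*} [RCLike 𝕜] [SeminormedAddCommGroup E]
    [NormedSpace 𝕜 E] [SeminormedAddCommGroup F] [NormedSpace 𝕜 F] (Φ : StrongDual 𝕜 (E × F)) :
    ‖Φ.comp (.inl 𝕜 E F)‖ + ‖Φ.comp (.inr 𝕜 E F)‖ ≤ ‖Φ‖ := by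
  set f := Φ.comp (.inl 𝕜 E F) with hf
  set g := Φ.comp (.inr 𝕜 E F) with hg
  -- Both summands are made nonnegative by unimodular factors `s` and `t`, and the arguments are scaled
  -- to the common norm `‖a‖ * ‖b‖`, so that no division by a possibly vanishing norm occurs.
  have key : ∀ a b, ‖f a‖ * ‖b‖ + ‖g b‖ * ‖a‖ ≤ ‖Φ‖ * (‖a‖ * ‖b‖) := by
    intro a b
    obtain ⟨s, hs, hsf⟩ : ∃ s : 𝕜, ‖s‖ = 1 ∧ s * f a = ‖f a‖ :=
      (RCLike.exists_norm_eq_mul_self _).imp fun s h => ⟨h.1, h.2.symm⟩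
    obtain ⟨t, ht, htg⟩ : ∃ t : 𝕜, ‖t‖ = 1 ∧ t * g b = ‖g b‖ :=
      (RCLike.exists_norm_eq_mul_self _).imp fun s h => ⟨h.1, h.2.symm⟩
    have h1 := Φ.le_opNorm ((s * (‖b‖ : 𝕜)) • a, (t * (‖a‖ : 𝕜)) • b)
    have h2 : Φ ((s * (‖b‖ : 𝕜)) • a, (t * (‖a‖ : 𝕜)) • b)
        = ((‖f a‖ * ‖b‖ + ‖g b‖ * ‖a‖ : ℝ) : 𝕜) := by
      have : ((s * (‖b‖ : 𝕜)) • a, (t * (‖a‖ : 𝕜)) • b)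
          = (s * (‖b‖ : 𝕜)) • (ContinuousLinearMap.inl 𝕜 E F a) + (t * (‖a‖ : 𝕜)) •
            (ContinuousLinearMap.inr 𝕜 E F b) := by simp
      rw [this, map_add, map_smul, map_smul]
      change (s * (‖b‖ : 𝕜)) * f a + (t * (‖a‖ : 𝕜)) * g b = _
      simp only [RCLike.ofReal_add, RCLike.ofReal_mul]
      linear_combination (‖b‖ : 𝕜) * hsf + (‖a‖ : 𝕜) * htg
    rw [h2, RCLike.norm_ofReal, abs_of_nonneg (by positivity)] at h1
    refine h1.trans_eq ?_
    simp [Prod.norm_def, norm_smul, hs, ht, mul_comm]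
  have hfle : ∀ b, ‖g b‖ ≤ (‖Φ‖ - ‖f‖) * ‖b‖ := by
    intro b
    rcases (norm_nonneg b).eq_or_lt with hb | hb
    · have := g.le_opNorm b
      rw [← hb, mul_zero] at this ⊢
      exact this
    · have hgb : ‖g b‖ ≤ ‖Φ‖ * ‖b‖ := by
        simpa [hg, Prod.norm_def] using Φ.le_opNorm (ContinuousLinearMap.inr 𝕜 E F b)
      have hfb : ‖f‖ ≤ ‖Φ‖ - ‖g b‖ / ‖b‖ := by
        refine f.opNorm_le_bound ?_ fun a => ?_
        · rw [sub_nonneg, div_le_iff₀ hb]; exact hgb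
        · have := key a b
          rw [← mul_le_mul_iff_left₀ hb]
          have e : ‖g b‖ / ‖b‖ * ‖b‖ = ‖g b‖ := div_mul_cancel₀ _ hb.ne'
          calc ‖f a‖ * ‖b‖ ≤ ‖Φ‖ * (‖a‖ * ‖b‖) - ‖g b‖ * ‖a‖ := by linarith
            _ = ‖Φ‖ * (‖a‖ * ‖b‖) - (‖g b‖ / ‖b‖ * ‖b‖) * ‖a‖ := by rw [e]
            _ = _ := by ring
      have : ‖g b‖ / ‖b‖ ≤ ‖Φ‖ - ‖f‖ := by linarith
      rwa [div_le_iff₀ hb] at this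
  have hΦ : ‖f‖ ≤ ‖Φ‖ := by
    refine f.opNorm_le_bound (norm_nonneg _) fun a => ?_
    simpa [hf, Prod.norm_def] using Φ.le_opNorm (ContinuousLinearMap.inl 𝕜 E F a)
  have := g.opNorm_le_bound (by linarith) hfle
  linarith

/-- A two-ball property of M-ideals. By Hahn–Banach it suffices to bound `f (x + y) + g (x - y)` for
functionals with `‖f‖ + ‖g‖ ≤ 1` and `f + g ∈ J^⊥`. The components of `f` and `g` in the complement of
`J^⊥` are then opposite, hence cancel on `x`, while the components in `J^⊥` vanish on `y`. -/
theorem IsMIdeal.exists_norm_add_sub_le {𝕜 E : Type*} [RCLike 𝕜] [SeminormedAddCommGroup E]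
    [NormedSpace 𝕜 E] {J : Submodule 𝕜 E} (hJ : IsMIdeal J) {x y : E} (hx : ‖x‖ ≤ 1)
    (hy : ‖y‖ ≤ 1) (hyJ : y ∈ J) {ε : ℝ} (hε : 0 < ε) :
    ∃ k ∈ J, ‖x + y - k‖ ≤ 1 + ε ∧ ‖x - y - k‖ ≤ 1 + ε := by
  obtain ⟨-, N, hN, hadd⟩ := hJ
  let D : Submodule 𝕜 (E × E) := J.map (LinearMap.id.prod LinearMap.id)
  let q : (E × E) →L[𝕜] (E × E) ⧸ D := D.mkQ.mkContinuous 1 fun m => by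
    rw [one_mul]; exact Submodule.Quotient.norm_mk_le D m
  have hq : ‖q‖ ≤ 1 := LinearMap.mkContinuous_norm_le _ zero_le_one _
  -- The distance of `(x + y, x - y)` to the diagonal copy of `J` is at most one.
  have hdist : ‖q (x + y, x - y)‖ ≤ 1 := by
    obtain ⟨φ, hφ, hφp⟩ := exists_dual_vector'' 𝕜 (q (x + y, x - y))
    set Φ := φ.comp q with hΦ
    have hΦ1 : ‖Φ‖ ≤ 1 := (φ.opNorm_comp_le q).trans (by nlinarith [norm_nonneg φ, norm_nonneg q])
    set f := Φ.comp (.inl 𝕜 E E) with hf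
    set g := Φ.comp (.inr 𝕜 E E) with hg
    have hfg : ‖f‖ + ‖g‖ ≤ 1 := (norm_comp_inl_add_norm_comp_inr_le Φ).trans hΦ1
    have hsplit : ∀ a b, Φ (a, b) = f a + g b := fun a b => by
      change _ = Φ (a, 0) + Φ (0, b)
      rw [← map_add]; simp
    have hann : f + g ∈ dualAnnihil J := fun k hk => by
      rw [add_apply, ← hsplit]
      have : q (k, k) = 0 := (Submodule.Quotient.mk_eq_zero D).2 ⟨k, hk, rfl⟩
      rw [hΦ, ContinuousLinearMap.comp_apply, this, map_zero]
    obtain ⟨f₁, hf₁, f₂, hf₂, hf'⟩ : ∃ f₁ ∈ N, ∃ f₂ ∈ dualAnnihil J, f₁ + f₂ = f :=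
      Submodule.mem_sup.1 (hN.sup_eq_top ▸ Submodule.mem_top)
    obtain ⟨g₁, hg₁, g₂, hg₂, hg'⟩ : ∃ g₁ ∈ N, ∃ g₂ ∈ dualAnnihil J, g₁ + g₂ = g :=
      Submodule.mem_sup.1 (hN.sup_eq_top ▸ Submodule.mem_top)
    have h1 : f₁ + g₁ = 0 := by
      refine (Submodule.disjoint_def.1 hN.disjoint) _ (N.add_mem hf₁ hg₁) ?_
      have : f₁ + g₁ = (f + g) - (f₂ + g₂) := by rw [← hf', ← hg']; abel
      rw [this]
      exact Submodule.sub_mem _ hann (Submodule.add_mem _ hf₂ hg₂)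
    have hnf := hadd f₁ hf₁ f₂ hf₂
    have hng := hadd g₁ hg₁ g₂ hg₂
    rw [hf'] at hnf
    rw [hg'] at hng
    have hval : Φ (x + y, x - y) = (f₂ + g₂) x + (f₁ - g₁) y := by
      have e1 : f₁ x + g₁ x = 0 := by rw [← add_apply, h1, zero_apply]
      have e2 : f₂ y = 0 := hf₂ y hyJ
      have e3 : g₂ y = 0 := hg₂ y hyJ
      rw [hsplit, ← hf', ← hg']
      simp only [add_apply, sub_apply, map_add, map_sub]
      linear_combination e1 + e2 - e3
    have hle : ‖Φ (x + y, x - y)‖ ≤ 1 := by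
      rw [hval]
      have b1 := ((f₂ + g₂).le_opNorm_of_le hx).trans
        (mul_le_mul_of_nonneg_right (norm_add_le f₂ g₂) zero_le_one)
      have b2 := ((f₁ - g₁).le_opNorm_of_le hy).trans
        (mul_le_mul_of_nonneg_right (norm_sub_le f₁ g₁) zero_le_one)
      have b3 := norm_add_le ((f₂ + g₂) x) ((f₁ - g₁) y)
      linarith
    rw [hΦ, ContinuousLinearMap.comp_apply, hφp, RCLike.norm_ofReal, abs_norm] at hle
    exact hle
  obtain ⟨m, hm, hmε⟩ := Submodule.Quotient.norm_mk_lt (q (x + y, x - y)) hε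
  obtain ⟨k, hk, hkm⟩ := (Submodule.Quotient.eq D).1 hm.symm
  have hk1 : x + y - k = m.1 := by
    have : k = x + y - m.1 := congrArg Prod.fst hkm
    rw [this]; abel
  have hk2 : x - y - k = m.2 := by
    have : k = x - y - m.2 := congrArg Prod.snd hkm
    rw [this]; abel
  refine ⟨k, hk, ?_, ?_⟩
  · rw [hk1]; linarith [norm_fst_le m]
  · rw [hk2]; linarith [norm_snd_le m]

theorem numericalIndex_mul_norm_le {𝕜 E : Type*} [RCLike 𝕜] [NormedAddCommGroup E]
    [NormedSpace 𝕜 E] (A : E →L[𝕜] E) {C : ℝ}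
    (hA : ∀ p ∈ statePairs 𝕜 E, ‖p.1 (A p.2)‖ ≤ C) (hC : 0 ≤ C) :
    numericalIndex 𝕜 E * ‖A‖ ≤ C := by
  rcases eq_or_ne A 0 with rfl | hA0
  · simpa using hC
  have hpos : 0 < ‖A‖ := norm_pos_iff.2 hA0
  have h1 : ‖((‖A‖⁻¹ : ℝ) : 𝕜) • A‖ = 1 := by
    rw [norm_smul, RCLike.norm_ofReal, abs_of_pos (inv_pos.2 hpos), inv_mul_cancel₀ hpos.ne']
  have h2 : numericalIndex 𝕜 E ≤ numericalRadius (((‖A‖⁻¹ : ℝ) : 𝕜) • A) :=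
    ciInf_le (f := fun T : {T : E →L[𝕜] E // ‖T‖ = 1} => numericalRadius T.1)
      ⟨0, by rintro _ ⟨T, rfl⟩; exact Real.iSup_nonneg fun _ => norm_nonneg _⟩ ⟨_, h1⟩
  have h3 : numericalRadius (((‖A‖⁻¹ : ℝ) : 𝕜) • A) ≤ ‖A‖⁻¹ * C := by
    refine Real.iSup_le (fun p => ?_) (by positivity)
    rw [smul_apply, map_smul, norm_smul, RCLike.norm_ofReal, abs_of_pos (inv_pos.2 hpos)]
    exact mul_le_mul_of_nonneg_left (hA p.1 p.2) (inv_pos.2 hpos).le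
  calc numericalIndex 𝕜 E * ‖A‖ ≤ ‖A‖⁻¹ * C * ‖A‖ :=
        mul_le_mul_of_nonneg_right (h2.trans h3) hpos.le
    _ = C := by field_simp

/-- The two-ball property for the ideal of compact operators, evaluated at states. -/
theorem exists_isCompactOperator_of_isMIdeal {𝕜 E : Type*} [RCLike 𝕜] [NormedAddCommGroup E]
    [NormedSpace 𝕜 E] (hM : IsMIdeal (numRadCompact 𝕜 E)) {T S : E →L[𝕜] E} (hT : ‖T‖ ≤ 1)
    (hS : ‖S‖ ≤ 1) (hSc : IsCompactOperator S) {ε : ℝ} (hε : 0 < ε) :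
    ∃ K : E →L[𝕜] E, IsCompactOperator K ∧ ∀ p ∈ statePairs 𝕜 E,
      ‖p.1 ((T + S - K) p.2)‖ ≤ 1 + ε ∧ ‖p.1 ((T - S - K) p.2)‖ ≤ 1 + ε := by
  have hle : ∀ A : E →L[𝕜] E, ‖(NumRadOp.toCLM 𝕜 E).symm A‖ ≤ ‖A‖ := fun A =>
    Real.iSup_le (fun p => norm_apply_le_of_mem_statePairs A p) (norm_nonneg A)
  obtain ⟨K, hK, h1, h2⟩ := hM.exists_norm_add_sub_le ((hle T).trans hT) ((hle S).trans hS)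
    (show S ∈ compactOperator (RingHom.id 𝕜) E E from hSc) hε
  exact ⟨NumRadOp.toCLM 𝕜 E K, hK, fun p hp =>
    ⟨(le_ciSup (bddAbove_numericalRadius (T + S - NumRadOp.toCLM 𝕜 E K)) ⟨p, hp⟩).trans h1,
      (le_ciSup (bddAbove_numericalRadius (T - S - NumRadOp.toCLM 𝕜 E K)) ⟨p, hp⟩).trans h2⟩⟩

/-! ### Subspaces of finite codimension and compact operators -/

theorem not_finiteDimensional_strongDual {𝕜 X : Type*} [RCLike 𝕜] [NormedAddCommGroup X]
    [NormedSpace 𝕜 X] (hdim : ¬ FiniteDimensional 𝕜 X) :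
    ¬ FiniteDimensional 𝕜 (StrongDual 𝕜 X) := fun h => by
  let L : X →ₗ[𝕜] Module.Dual 𝕜 (StrongDual 𝕜 X) :=
    (ContinuousLinearMap.coeLM 𝕜).comp (NormedSpace.inclusionInDoubleDual 𝕜 X).toLinearMap
  have hL : Function.Injective L := ContinuousLinearMap.coe_injective.comp
    (NormedSpace.inclusionInDoubleDualLi (E := X) 𝕜).injective
  exact hdim (FiniteDimensional.of_injective L hL)

theorem exists_mem_finCodim_norm_eq_one {𝕜 E ι : Type*} [RCLike 𝕜] [NormedAddCommGroup E]
    [NormedSpace 𝕜 E] [Finite ι] (hdim : ¬ FiniteDimensional 𝕜 E) {Y : Submodule 𝕜 E}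
    (hY : Y ∈ FinCodim 𝕜 E) (φ : ι → E →ₗ[𝕜] 𝕜) :
    ∃ y ∈ Y, ‖y‖ = 1 ∧ ∀ i, φ i y = 0 := by
  have := hY.2
  let L : E →ₗ[𝕜] (E ⧸ Y) × (ι → 𝕜) := Y.mkQ.prod (LinearMap.pi φ)
  have hL : ¬ Function.Injective L := fun h => hdim (FiniteDimensional.of_injective L h)
  rw [← LinearMap.ker_eq_bot] at hL
  obtain ⟨y, hy, hy0⟩ := Submodule.exists_mem_ne_zero_of_ne_bot hL
  have hyL : L y = 0 := hy
  refine ⟨((‖y‖⁻¹ : ℝ) : 𝕜) • y, Y.smul_mem _ ?_, ?_, fun i => ?_⟩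
  · exact (Submodule.Quotient.mk_eq_zero Y).1 (congrArg Prod.fst hyL)
  · rw [norm_smul, RCLike.norm_ofReal, abs_of_nonneg (by positivity),
      inv_mul_cancel₀ (norm_ne_zero_iff.2 hy0)]
  · rw [map_smul, show φ i y = 0 from congrFun (congrArg Prod.snd hyL) i, smul_zero]

theorem IsCompactOperator.exists_finite_net {𝕜 E F : Type*} [RCLike 𝕜] [NormedAddCommGroup E]
    [NormedSpace 𝕜 E] [NormedAddCommGroup F] [NormedSpace 𝕜 F] {K : E →L[𝕜] F}
    (hK : IsCompactOperator K) {η : ℝ} (hη : 0 < η) :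
    ∃ t : Set F, t.Finite ∧ ∀ x, ‖x‖ ≤ 1 → ∃ k ∈ t, ‖K x - k‖ < η := by
  obtain ⟨C, hC, hsub⟩ := hK.image_closedBall_subset_compact (f := (K : E →ₗ[𝕜] F)) 1
  obtain ⟨t, -, ht, hcov⟩ := hC.finite_cover_balls hη
  refine ⟨t, ht, fun x hx => ?_⟩
  have := hcov (hsub ⟨x, by simpa using hx, rfl⟩)
  simp only [Set.mem_iUnion, mem_ball_iff_norm] at this
  obtain ⟨k, hk, h⟩ := this
  exact ⟨k, hk, h⟩

theorem IsCompactOperator.exists_mem_finCodim_norm_apply_le {𝕜 X F : Type*} [RCLike 𝕜]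
    [NormedAddCommGroup X] [NormedSpace 𝕜 X] [NormedAddCommGroup F] [NormedSpace 𝕜 F]
    (hdim : ¬ FiniteDimensional 𝕜 X) {K : X →L[𝕜] F}
    (hK : IsCompactOperator K) {Y : Submodule 𝕜 X} (hY : Y ∈ FinCodim 𝕜 X) {η : ℝ} (hη : 0 < η) :
    ∃ y ∈ Y, ‖y‖ = 1 ∧ ‖K y‖ ≤ η := by
  obtain ⟨t, ht, hnet⟩ := hK.exists_finite_net (half_pos hη)
  have := ht.to_subtype
  choose g hg hgk using fun k : F => exists_dual_vector'' 𝕜 k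
  obtain ⟨y, hyY, hy, h0⟩ := exists_mem_finCodim_norm_eq_one hdim hY
    (fun k : t => ((g k).comp K).toLinearMap)
  refine ⟨y, hyY, hy, ?_⟩
  obtain ⟨k, hk, hky⟩ := hnet y hy.le
  have hgy : g k (K y) = 0 := h0 ⟨k, hk⟩
  -- A functional norming `k` annihilates `K y`, so `‖k‖ ≤ ‖K y - k‖`.
  have h1 : ‖k‖ ≤ ‖K y - k‖ := by
    have := (g k).le_of_opNorm_le (hg k) (K y - k)
    rwa [map_sub, hgy, hgk, zero_sub, norm_neg, RCLike.norm_ofReal, abs_norm, one_mul] at this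
  linarith [norm_le_norm_sub_add (K y) k]

/-- The adjoint of a compact operator is small on a subspace of finite codimension: a norm-one
functional that vanishes on a finite `η`-net of the image of the unit ball is at most `η` there. -/
theorem IsCompactOperator.exists_mem_finCodim_norm_comp_le {𝕜 X F : Type*} [RCLike 𝕜]
    [NormedAddCommGroup X] [NormedSpace 𝕜 X] [NormedAddCommGroup F] [NormedSpace 𝕜 F]
    (hdim : ¬ FiniteDimensional 𝕜 F) {K : X →L[𝕜] F} (hK : IsCompactOperator K)
    {Y : Submodule 𝕜 (StrongDual 𝕜 F)} (hY : Y ∈ FinCodim 𝕜 (StrongDual 𝕜 F)) {η : ℝ}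
    (hη : 0 < η) :
    ∃ h ∈ Y, ‖h‖ = 1 ∧ ‖h.comp K‖ ≤ η := by
  obtain ⟨t, ht, hnet⟩ := hK.exists_finite_net hη
  have := ht.to_subtype
  obtain ⟨h, hhY, hh, h0⟩ := exists_mem_finCodim_norm_eq_one (not_finiteDimensional_strongDual hdim)
    hY (fun k : t => (NormedSpace.inclusionInDoubleDual 𝕜 F k).toLinearMap)
  refine ⟨h, hhY, hh, ContinuousLinearMap.opNorm_le_of_unit_norm hη.le fun x hx => ?_⟩
  obtain ⟨k, hk, hkx⟩ := hnet x hx.le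
  have hhk : h k = 0 := h0 ⟨k, hk⟩
  have := h.le_of_opNorm_le hh.le (K x - k)
  rw [map_sub, hhk, sub_zero, one_mul] at this
  exact this.trans hkx.le

/-! ### Bounds for the asymptotic moduli -/

/-- The kernel of a functional norming `x` is a subspace on which `‖x + y‖ ≥ ‖x‖`. Infinite
dimension is used to bound the supremum defining the modulus from above, so that it is not a junk
value. -/
theorem aucModulusAt_one_nonneg {𝕜 E : Type*} [RCLike 𝕜] [NormedAddCommGroup E]
    [NormedSpace 𝕜 E] (hdim : ¬ FiniteDimensional 𝕜 E) {x : E} (hx : ‖x‖ = 1) :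
    0 ≤ aucModulusAt 𝕜 x 1 := by
  obtain ⟨f, hf, hfx⟩ := exists_dual_vector'' 𝕜 x
  have hY : f.ker ∈ FinCodim 𝕜 E := ⟨f.isClosed_ker,
    (f.toLinearMap.quotKerEquivRange).symm.finiteDimensional⟩
  have hbdd : BddAbove (Set.range fun Y : FinCodim 𝕜 E =>
      ⨅ y : {y : E // y ∈ Y.1 ∧ (1 : ℝ) ≤ ‖y‖}, (‖x + y.1‖ - 1)) := by
    refine ⟨1, ?_⟩
    rintro _ ⟨Y, rfl⟩
    obtain ⟨y, hyY, hy, -⟩ := exists_mem_finCodim_norm_eq_one hdim Y.2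
      (fun i : Fin 0 => (0 : E →ₗ[𝕜] 𝕜))
    refine (ciInf_le ⟨-1, ?_⟩ ⟨y, hyY, hy.ge⟩).trans ?_
    · rintro _ ⟨z, rfl⟩
      linarith [norm_nonneg (x + z.1)]
    · linarith [norm_add_le x y]
  refine le_ciSup_of_le hbdd ⟨_, hY⟩ (Real.iInf_nonneg fun y => ?_)
  have h1 := f.le_of_opNorm_le hf (x + y.1)
  rw [map_add, show f y.1 = 0 from y.2.1, add_zero, hfx, RCLike.norm_ofReal, abs_norm, hx] at h1
  linarith

theorem aucModulus_one_nonneg {𝕜 E : Type*} [RCLike 𝕜] [NormedAddCommGroup E]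
    [NormedSpace 𝕜 E] (hdim : ¬ FiniteDimensional 𝕜 E) : 0 ≤ aucModulus 𝕜 E 1 :=
  Real.iInf_nonneg fun x => aucModulusAt_one_nonneg hdim x.2

theorem one_add_aucModulus_le {𝕜 E : Type*} [RCLike 𝕜] [NormedAddCommGroup E]
    [NormedSpace 𝕜 E] (hdim : ¬ FiniteDimensional 𝕜 E) {u : E} (hu : ‖u‖ = 1) {C : ℝ}
    (h : ∀ Y ∈ FinCodim 𝕜 E, ∀ ε > 0, ∃ y ∈ Y, ‖y‖ = 1 ∧ ‖u + y‖ ≤ C + ε) :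
    1 + aucModulus 𝕜 E 1 ≤ C := by
  have h1 : aucModulus 𝕜 E 1 ≤ aucModulusAt 𝕜 u 1 :=
    ciInf_le (f := fun x : {x : E // ‖x‖ = 1} => aucModulusAt 𝕜 x.1 1)
      ⟨0, by rintro _ ⟨x, rfl⟩; exact aucModulusAt_one_nonneg hdim x.2⟩ ⟨u, hu⟩
  have : Nonempty (FinCodim 𝕜 E) := ⟨⟨⊤, isClosed_univ, inferInstance⟩⟩
  have h2 : aucModulusAt 𝕜 u 1 ≤ C - 1 := by
    refine ciSup_le fun Y => le_of_forall_pos_le_add fun ε hε => ?_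
    obtain ⟨y, hyY, hy, hle⟩ := h Y.1 Y.2 ε hε
    refine (ciInf_le ⟨-1, ?_⟩ ⟨y, hyY, hy.ge⟩).trans ?_
    · rintro _ ⟨z, rfl⟩
      linarith [norm_nonneg (u + z.1)]
    · linarith
  linarith

theorem le_one_add_ausModulus {𝕜 E : Type*} [RCLike 𝕜] [NormedAddCommGroup E]
    [NormedSpace 𝕜 E] {u : E} (hu : ‖u‖ = 1) {c : ℝ}
    (h : ∀ Y ∈ FinCodim 𝕜 E, ∀ ε > 0, ∃ y ∈ Y, ‖y‖ ≤ 1 ∧ c - ε ≤ ‖u + y‖) :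
    c ≤ 1 + ausModulus 𝕜 E 1 := by
  have hbdd : ∀ (x : E) (Y : FinCodim 𝕜 E), BddAbove (Set.range
      fun y : {y : E // y ∈ Y.1 ∧ ‖y‖ ≤ (1 : ℝ)} => (‖x + y.1‖ - 1)) := by
    refine fun x Y => ⟨‖x‖, ?_⟩
    rintro _ ⟨y, rfl⟩
    linarith [norm_add_le x y.1, y.2.2]
  have : Nonempty (FinCodim 𝕜 E) := ⟨⟨⊤, isClosed_univ, inferInstance⟩⟩
  have h1 : ausModulusAt 𝕜 u 1 ≤ ausModulus 𝕜 E 1 := by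
    refine le_ciSup (f := fun x : {x : E // ‖x‖ = 1} => ausModulusAt 𝕜 x.1 1) ⟨1, ?_⟩ ⟨u, hu⟩
    rintro _ ⟨⟨x, hx⟩, rfl⟩
    refine (ciInf_le ⟨0, ?_⟩ (Classical.arbitrary _)).trans (Real.iSup_le (fun y => ?_) zero_le_one)
    · rintro _ ⟨Y, rfl⟩
      refine le_ciSup_of_le (hbdd x Y) ⟨0, Y.1.zero_mem, by simp⟩ ?_
      simp [hx]
    · linarith [norm_add_le x y.1, y.2.2]
  have h2 : c - 1 ≤ ausModulusAt 𝕜 u 1 := by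
    refine le_ciInf fun Y => le_of_forall_pos_sub_le fun ε hε => ?_
    obtain ⟨y, hyY, hy, hle⟩ := h Y.1 Y.2 ε hε
    exact le_ciSup_of_le (hbdd u Y) ⟨y, hyY, hy⟩ (by linarith)
  linarith

/-! ### Perturbed compact operators on the sums `X ⊕_∞ X` and `X ⊕₁ X` -/

theorem isCompactOperator_smulRight {𝕜 E F : Type*} [RCLike 𝕜] [NormedAddCommGroup E]
    [NormedSpace 𝕜 E] [NormedAddCommGroup F] [NormedSpace 𝕜 F] (w : StrongDual 𝕜 E) (u : F) :
    IsCompactOperator (w.smulRight u) :=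
  (isCompactOperator_of_locallyCompactSpace_dom w).clm_comp (.toSpanSingleton 𝕜 u)

theorem norm_le_of_two_mul_eq_add {𝕜 : Type*} [RCLike 𝕜] {a b c : 𝕜} {r : ℝ} (hb : ‖b‖ ≤ r)
    (hc : ‖c‖ ≤ r) (h : 2 * a = b + c) : ‖a‖ ≤ r := by
  have h1 := norm_add_le b c
  rw [← h, norm_mul, RCLike.norm_ofNat] at h1
  linarith

theorem exists_norm_eq_one (𝕜 X : Type*) [RCLike 𝕜] [NormedAddCommGroup X] [NormedSpace 𝕜 X]
    [Nontrivial X] : ∃ x : X, ‖x‖ = 1 := by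
  obtain ⟨x, hx⟩ := exists_ne (0 : X)
  exact ⟨_, norm_smul_inv_norm (𝕜 := 𝕜) hx⟩

/-- A state `f` of `X` at `x` extends to a state of `X ⊕_∞ X` at `(x, y)` for every `y` in the unit
ball. Hence for `T = (x, y) ↦ (x, 0)` and `S = (x, y) ↦ (w₀ y • u, 0)`, whose numerical radii are at
most one, the second coordinate is a free parameter that produces `w ⊗ u` for all `w` in the dual
unit ball at once, with the same `K`. -/
theorem exists_isCompactOperator_norm_le_of_isMIdeal_prod {𝕜 X : Type*} [RCLike 𝕜]
    [NormedAddCommGroup X] [NormedSpace 𝕜 X] (hM : IsMIdeal (numRadCompact 𝕜 (X × X))) {u : X}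
    (hu : ‖u‖ = 1) {ε : ℝ} (hε : 0 < ε) :
    ∃ K : X →L[𝕜] X, IsCompactOperator K ∧ ∀ w : StrongDual 𝕜 X, ‖w‖ ≤ 1 →
      numericalIndex 𝕜 X * ‖.id 𝕜 X - K + w.smulRight u‖ ≤ 1 + ε := by
  obtain ⟨w₀, hw₀, hw₀u⟩ := exists_dual_vector'' 𝕜 u
  rw [hu, RCLike.ofReal_one] at hw₀u
  let T : X × X →L[𝕜] X × X := (ContinuousLinearMap.inl 𝕜 X X).comp (.fst 𝕜 X X)
  let S : X × X →L[𝕜] X × X :=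
    (ContinuousLinearMap.inl 𝕜 X X).comp ((w₀.smulRight u).comp (.snd 𝕜 X X))
  have hT : ‖T‖ ≤ 1 := T.opNorm_le_bound zero_le_one fun z => by
    simp [T, Prod.norm_def]
  have hS : ‖S‖ ≤ 1 := S.opNorm_le_bound zero_le_one fun z => by
    have := (w₀.le_of_opNorm_le hw₀ z.2).trans
      (mul_le_mul_of_nonneg_left (norm_snd_le z) zero_le_one)
    simpa [S, Prod.norm_def, norm_smul, hu] using this
  have hSc : IsCompactOperator S :=
    ((isCompactOperator_smulRight w₀ u).comp_clm (.snd 𝕜 X X)).clm_comp (.inl 𝕜 X X)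
  obtain ⟨K, hK, hKv⟩ := exists_isCompactOperator_of_isMIdeal hM hT hS hSc hε
  refine ⟨(ContinuousLinearMap.fst 𝕜 X X).comp (K.comp (.inl 𝕜 X X)),
    (hK.comp_clm (.inl 𝕜 X X)).clm_comp (.fst 𝕜 X X), fun w hw => ?_⟩
  refine numericalIndex_mul_norm_le _ ?_ (by positivity)
  rintro ⟨f, x⟩ ⟨hf, hx, hfx⟩
  simp only at hf hx hfx
  have hwx : ‖w x‖ ≤ 1 := by simpa [hx] using w.le_of_opNorm_le hw x
  have hstate : ∀ y : X, ‖y‖ ≤ 1 →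
      (f.comp (.fst 𝕜 X X), (x, y)) ∈ statePairs 𝕜 (X × X) := by
    intro y hy
    refine ⟨le_antisymm ?_ ?_, by simp [Prod.norm_def, hx, hy], by simpa using hfx⟩
    · refine ContinuousLinearMap.opNorm_le_bound _ zero_le_one fun z => ?_
      have := (f.le_of_opNorm_le hf.le z.1).trans
        (mul_le_mul_of_nonneg_left (norm_fst_le z) zero_le_one)
      simpa using this
    · have := (f.comp (.fst 𝕜 X X)).le_opNorm (x, 0)
      simpa [hfx, Prod.norm_def, hx] using this
  -- With this second coordinate, `S` takes the value `(w x • u, 0)`, as `w₀ u = 1`.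
  have hy : ‖w x • u‖ ≤ 1 := by rwa [norm_smul, hu, mul_one]
  have h1 := (hKv _ (hstate (w x • u) hy)).1
  have h2 := (hKv _ (hstate (-(w x • u)) (by rwa [norm_neg]))).2
  refine norm_le_of_two_mul_eq_add h1 h2 ?_
  -- Changing the sign of the second coordinate cancels the second column of `K`.
  have hcol : f (K (x, w x • u)).1 + f (K (x, -(w x • u))).1 = 2 * f (K (x, 0)).1 := by
    rw [← map_add, ← Prod.fst_add, ← map_add, two_mul, ← map_add, ← Prod.fst_add, ← map_add]
    simp
  simp only [T, S, add_apply, sub_apply, ContinuousLinearMap.comp_apply, map_add, map_sub,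
    ContinuousLinearMap.coe_fst', ContinuousLinearMap.coe_snd', ContinuousLinearMap.inl_apply,
    ContinuousLinearMap.smulRight_apply, ContinuousLinearMap.id_apply, map_smul, map_neg, hw₀u,
    smul_eq_mul] at hcol ⊢
  linear_combination hcol

/-- A state `f` of `X` at `x` extends to a state `(f, g)` of `X ⊕₁ X` at `(x, 0)` for every `g` in the
dual unit ball. Hence for `T = (x, y) ↦ (x, 0)` and `S = (x, y) ↦ (0, w x • y₀)` the functional `g`
is a free parameter that produces `w ⊗ e` for all `e` in the unit ball at once, with the same
`K`. -/
theorem exists_isCompactOperator_norm_le_of_isMIdeal_withLp {𝕜 X : Type*} [RCLike 𝕜]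
    [NormedAddCommGroup X] [NormedSpace 𝕜 X] (hM : IsMIdeal (numRadCompact 𝕜 (WithLp 1 (X × X))))
    {w : StrongDual 𝕜 X} (hw : ‖w‖ = 1) {ε : ℝ} (hε : 0 < ε) :
    ∃ K : X →L[𝕜] X, IsCompactOperator K ∧ ∀ e : X, ‖e‖ ≤ 1 →
      numericalIndex 𝕜 X * ‖.id 𝕜 X - K + w.smulRight e‖ ≤ 1 + ε := by
  let Z := WithLp 1 (X × X)
  let P₁ : Z →L[𝕜] X := WithLp.fstL 1 𝕜 X X
  let P₂ : Z →L[𝕜] X := WithLp.sndL 1 𝕜 X X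
  let I₁ : X →L[𝕜] Z :=
    (WithLp.prodContinuousLinearEquiv 1 𝕜 X X).symm.toContinuousLinearMap.comp (.inl 𝕜 X X)
  let I₂ : X →L[𝕜] Z :=
    (WithLp.prodContinuousLinearEquiv 1 𝕜 X X).symm.toContinuousLinearMap.comp (.inr 𝕜 X X)
  have hP : ∀ z : Z, ‖z‖ = ‖P₁ z‖ + ‖P₂ z‖ := WithLp.prod_norm_eq_of_L1
  have h11 : ∀ x, P₁ (I₁ x) = x := fun _ => rfl
  have h12 : ∀ x, P₁ (I₂ x) = 0 := fun _ => rfl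
  have h21 : ∀ x, P₂ (I₁ x) = 0 := fun _ => rfl
  have h22 : ∀ x, P₂ (I₂ x) = x := fun _ => rfl
  have hX : Nontrivial X := by
    by_contra h
    rw [not_nontrivial_iff_subsingleton] at h
    rw [Subsingleton.elim w 0, norm_zero] at hw
    exact zero_ne_one hw
  obtain ⟨y₀, hy₀⟩ := exists_norm_eq_one 𝕜 X
  obtain ⟨ψ, hψ, hψy⟩ := exists_dual_vector'' 𝕜 y₀
  rw [hy₀, RCLike.ofReal_one] at hψy
  let T : Z →L[𝕜] Z := I₁.comp P₁
  let S : Z →L[𝕜] Z := I₂.comp ((w.smulRight y₀).comp P₁)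
  have hT : ‖T‖ ≤ 1 := T.opNorm_le_bound zero_le_one fun z => by
    rw [hP (T z), hP z]
    simp only [T, ContinuousLinearMap.comp_apply, h11, h21, norm_zero]
    linarith [norm_nonneg (P₂ z)]
  have hS : ‖S‖ ≤ 1 := S.opNorm_le_bound zero_le_one fun z => by
    rw [hP (S z), hP z]
    simp only [S, ContinuousLinearMap.comp_apply, h12, h22, norm_zero,
      ContinuousLinearMap.smulRight_apply, norm_smul, hy₀]
    linarith [norm_nonneg (P₂ z), w.le_of_opNorm_le hw.le (P₁ z)]
  have hSc : IsCompactOperator S :=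
    ((isCompactOperator_smulRight w y₀).comp_clm P₁).clm_comp I₂
  obtain ⟨K, hK, hKv⟩ := exists_isCompactOperator_of_isMIdeal hM hT hS hSc hε
  refine ⟨P₁.comp (K.comp I₁), (hK.comp_clm I₁).clm_comp P₁, fun e he => ?_⟩
  refine numericalIndex_mul_norm_le _ ?_ (by positivity)
  rintro ⟨f, x⟩ ⟨hf, hx, hfx⟩
  simp only at hf hx hfx
  have hfe : ‖f e‖ ≤ 1 := by simpa using f.le_of_opNorm_le_of_le hf.le he
  have hstate : ∀ g : StrongDual 𝕜 X, ‖g‖ ≤ 1 →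
      (f.comp P₁ + g.comp P₂, I₁ x) ∈ statePairs 𝕜 Z := by
    intro g hg
    have hval : (f.comp P₁ + g.comp P₂) (I₁ x) = 1 := by
      simp only [add_apply, ContinuousLinearMap.comp_apply, h11, h21, hfx, map_zero, add_zero]
    have hnorm : ‖I₁ x‖ = 1 := by rw [hP, h11, h21, norm_zero, hx, add_zero]
    refine ⟨le_antisymm ?_ ?_, hnorm, hval⟩
    · refine ContinuousLinearMap.opNorm_le_bound _ zero_le_one fun z => ?_
      rw [hP z, mul_add]
      exact norm_add_le_of_le (f.le_of_opNorm_le hf.le _) (g.le_of_opNorm_le hg _)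
    · have := (f.comp P₁ + g.comp P₂).le_opNorm (I₁ x)
      rwa [hval, norm_one, hnorm, mul_one] at this
  -- With this second functional, the state takes the value `f e * w x` on `S`, as `ψ y₀ = 1`.
  have hg : ‖f e • ψ‖ ≤ 1 := by
    rw [norm_smul]
    exact mul_le_one₀ hfe (norm_nonneg _) hψ
  have h1 := (hKv _ (hstate (f e • ψ) hg)).1
  have h2 := (hKv _ (hstate (-(f e • ψ)) (by rwa [norm_neg]))).2
  refine norm_le_of_two_mul_eq_add h1 h2 ?_
  -- Changing the sign of the second functional cancels the second row of `K`.
  simp only [T, S, add_apply, sub_apply, ContinuousLinearMap.comp_apply, map_add, map_sub, h11, h12,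
    h21, h22, neg_apply, ContinuousLinearMap.smulRight_apply, ContinuousLinearMap.id_apply,
    map_smul, hψy, smul_eq_mul, smul_apply, map_zero]
  ring

/-! ### The estimates for the numerical index -/

theorem exists_apply_eq_ofReal {𝕜 X : Type*} [RCLike 𝕜] [NormedAddCommGroup X] [NormedSpace 𝕜 X]
    {h : StrongDual 𝕜 X} (hh : ‖h‖ = 1) {ε : ℝ} (hε : 0 < ε) :
    ∃ (z : X) (r : ℝ), ‖z‖ ≤ 1 ∧ 1 - ε < r ∧ r ≤ ‖z‖ ∧ h z = r := by
  obtain ⟨z, hz, hzr⟩ := h.exists_lt_apply_of_lt_opNorm (show 1 - ε < ‖h‖ by linarith)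
  obtain ⟨s, hs, hsz⟩ := RCLike.exists_norm_eq_mul_self (h z)
  have hle : ‖h z‖ ≤ ‖z‖ := by simpa using h.le_of_opNorm_le hh.le z
  refine ⟨s • z, ‖h z‖, ?_, hzr, ?_, ?_⟩
  · rw [norm_smul, hs, one_mul]; exact hz.le
  · rwa [norm_smul, hs, one_mul]
  · rw [map_smul, smul_eq_mul, hsz]

/-- The polarization identity `(f + h)(a + b) + (f - h)(a - b) = 2 (f a + h b)` turns upper bounds for
`‖a ± b‖` into a lower bound for one of `‖f ± h‖`, and vice versa. -/
theorem two_mul_norm_apply_add_apply_le {𝕜 E : Type*} [RCLike 𝕜] [NormedAddCommGroup E]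
    [NormedSpace 𝕜 E] (f h : StrongDual 𝕜 E) (a b : E) :
    2 * ‖f a + h b‖ ≤ ‖f + h‖ * ‖a + b‖ + ‖f - h‖ * ‖a - b‖ := by
  have h1 := norm_add_le_of_le ((f + h).le_opNorm (a + b)) ((f - h).le_opNorm (a - b))
  have h2 : (f + h) (a + b) + (f - h) (a - b) = 2 * (f a + h b) := by
    simp only [add_apply, sub_apply, map_add, map_sub]
    ring
  rwa [h2, norm_mul, RCLike.norm_ofNat] at h1

/-- The estimate for `X ⊕_∞ X`. On a vector `z` with `K z` small, the bound
`‖z - K z ± ‖z‖ u‖ ≤ ‖z‖ / n` estimates `‖u ± z‖`. On a vector `z` that almost norms a functional `h`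
with `h ∘ K` small, it yields a lower bound for `‖f ± h‖`, where `f` is norming for `u`. -/
theorem numericalIndex_le_of_isMIdeal_prod {𝕜 X : Type*} [RCLike 𝕜] [NormedAddCommGroup X]
    [NormedSpace 𝕜 X] (hdim : ¬ FiniteDimensional 𝕜 X) (hn : 0 < numericalIndex 𝕜 X)
    (hM : IsMIdeal (numRadCompact 𝕜 (X × X))) :
    numericalIndex 𝕜 X ≤
      min (1 / (1 + aucModulus 𝕜 X 1)) ((1 + ausModulus 𝕜 (StrongDual 𝕜 X) 1) / 2) := by
  set n := numericalIndex 𝕜 X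
  have hX : Nontrivial X := by
    by_contra h
    rw [not_nontrivial_iff_subsingleton] at h
    exact hdim inferInstance
  obtain ⟨u, hu⟩ := exists_norm_eq_one 𝕜 X
  obtain ⟨f, hf, hfu⟩ := exists_dual_vector 𝕜 u (by rw [hu]; exact one_ne_zero)
  rw [hu, RCLike.ofReal_one] at hfu
  have key : ∀ ε > 0, ∃ K : X →L[𝕜] X, IsCompactOperator K ∧ ∀ w : StrongDual 𝕜 X, ‖w‖ ≤ 1 →
      ∀ z, n * ‖z - K z + w z • u‖ ≤ (1 + ε) * ‖z‖ := by
    intro ε hε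
    obtain ⟨K, hK, hKn⟩ := exists_isCompactOperator_norm_le_of_isMIdeal_prod hM hu hε
    refine ⟨K, hK, fun w hw z => ?_⟩
    calc n * ‖z - K z + w z • u‖ ≤ n * (‖.id 𝕜 X - K + w.smulRight u‖ * ‖z‖) :=
          mul_le_mul_of_nonneg_left
            ((ContinuousLinearMap.id 𝕜 X - K + w.smulRight u).le_opNorm z) hn.le
      _ ≤ _ := by
          rw [← mul_assoc]
          exact mul_le_mul_of_nonneg_right (hKn w hw) (norm_nonneg z)
  refine le_min ?_ ?_
  · have hδ := aucModulus_one_nonneg hdim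
    rw [le_one_div hn (by linarith)]
    refine one_add_aucModulus_le hdim hu fun Y hY ε hε => ?_
    -- The tolerance `η = ε n / (1 + n)` solves `(1 + η) / n + η = 1 / n + ε`.
    obtain ⟨K, hK, hKn⟩ := key (ε * n / (1 + n)) (by positivity)
    obtain ⟨y, hyY, hy, hKy⟩ := hK.exists_mem_finCodim_norm_apply_le hdim hY
      (show 0 < ε * n / (1 + n) by positivity)
    refine ⟨y, hyY, hy, ?_⟩
    obtain ⟨w, hw, hwy⟩ := exists_dual_vector'' 𝕜 y
    have h1 := hKn w hw y
    rw [hwy, hy, RCLike.ofReal_one, one_smul, mul_one] at h1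
    have h2 : ‖u + y‖ ≤ ‖y - K y + u‖ + ‖K y‖ := by
      have e : u + y = y - K y + u + K y := by abel
      rw [e]
      exact norm_add_le _ _
    have h3 : ‖y - K y + u‖ ≤ (1 + ε * n / (1 + n)) / n := by
      rwa [le_div_iff₀ hn, mul_comm]
    have h4 : (1 + ε * n / (1 + n)) / n + ε * n / (1 + n) = 1 / n + ε := by
      field_simp
      ring
    linarith
  · rw [le_div_iff₀ two_pos]
    refine le_one_add_ausModulus hf fun Y hY ε hε => ?_
    -- If both `‖f ± h‖` were below `2 n - ε`, the errors of order `η` below would give `ε < 5 n η`.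
    set η := ε / (5 * n) with hη
    have hη0 : 0 < η := by positivity
    obtain ⟨K, hK, hKn⟩ := key η hη0
    obtain ⟨h, hhY, hh, hhK⟩ := hK.exists_mem_finCodim_norm_comp_le hdim hY hη0
    obtain ⟨z, r, hz, hr, hrz, hzr⟩ := exists_apply_eq_ofReal hh hη0
    obtain ⟨w, hw, hwz⟩ := exists_dual_vector'' 𝕜 z
    by_contra! hcon
    have hp := hcon h hhY hh.le
    have hm := hcon (-h) (Y.neg_mem hhY) (by rw [norm_neg]; exact hh.le)
    rw [← sub_eq_add_neg] at hm
    have h1 := hKn w hw z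
    have h2 := hKn (-w) (by rwa [norm_neg]) z
    rw [neg_apply, hwz] at h2
    rw [hwz] at h1
    have h3 := two_mul_norm_apply_add_apply_le f h ((‖z‖ : 𝕜) • u) (z - K z)
    have h4 : ‖z‖ + r - η ≤ ‖f ((‖z‖ : 𝕜) • u) + h (z - K z)‖ := by
      have e : f ((‖z‖ : 𝕜) • u) + h (z - K z) = ((‖z‖ + r : ℝ) : 𝕜) - h (K z) := by
        rw [map_smul, hfu, map_sub, hzr, smul_eq_mul, mul_one, RCLike.ofReal_add]
        ring
      have h5 := norm_sub_norm_le ((‖z‖ + r : ℝ) : 𝕜) (h (K z))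
      rw [← e, RCLike.norm_ofReal] at h5
      have h6 : ‖h (K z)‖ ≤ η * 1 := (h.comp K).le_of_opNorm_le_of_le hhK hz
      linarith [le_abs_self (‖z‖ + r)]
    rw [add_comm] at h1
    have h2' : ‖(‖z‖ : 𝕜) • u - (z - K z)‖ = ‖z - K z + -(‖z‖ : 𝕜) • u‖ := by
      rw [← norm_neg]; congr 1; module
    rw [← h2'] at h2
    have hb : (1 + η) * ‖z‖ ≤ 1 + η := by nlinarith
    have h6 := mul_le_mul_of_nonneg_left h3 hn.le
    have hm0 : 0 ≤ n * 2 - ε := (norm_nonneg _).trans hp.le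
    have h7 : ‖f + h‖ * (n * ‖(‖z‖ : 𝕜) • u + (z - K z)‖) ≤ (n * 2 - ε) * (1 + η) :=
      mul_le_mul hp.le (h1.trans hb) (by positivity) hm0
    have h8 : ‖f - h‖ * (n * ‖(‖z‖ : 𝕜) • u - (z - K z)‖) ≤ (n * 2 - ε) * (1 + η) :=
      mul_le_mul hm.le (h2.trans hb) (by positivity) hm0
    have h9 : n * (2 - 3 * η) ≤ n * ‖f ((‖z‖ : 𝕜) • u) + h (z - K z)‖ :=
      mul_le_mul_of_nonneg_left (by linarith) hn.le
    have h10 : ε = 5 * n * η := by rw [hη]; field_simp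
    nlinarith [mul_pos hε hη0]

/-- The estimate for `X ⊕₁ X`, where the bound `‖h - h ∘ K ± ‖h‖ f‖ ≤ ‖h‖ / n` for functionals `h`
takes the place of the bound for vectors in `numericalIndex_le_of_isMIdeal_prod`. -/
theorem numericalIndex_le_of_isMIdeal_withLp {𝕜 X : Type*} [RCLike 𝕜] [NormedAddCommGroup X]
    [NormedSpace 𝕜 X] (hdim : ¬ FiniteDimensional 𝕜 X) (hn : 0 < numericalIndex 𝕜 X)
    (hM : IsMIdeal (numRadCompact 𝕜 (WithLp 1 (X × X)))) :
    numericalIndex 𝕜 X ≤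
      min ((1 + ausModulus 𝕜 X 1) / 2) (1 / (1 + aucModulus 𝕜 (StrongDual 𝕜 X) 1)) := by
  set n := numericalIndex 𝕜 X
  have hX : Nontrivial X := by
    by_contra h
    rw [not_nontrivial_iff_subsingleton] at h
    exact hdim inferInstance
  obtain ⟨u, hu⟩ := exists_norm_eq_one 𝕜 X
  obtain ⟨f, hf, hfu⟩ := exists_dual_vector 𝕜 u (by rw [hu]; exact one_ne_zero)
  rw [hu, RCLike.ofReal_one] at hfu
  have key : ∀ ε > 0, ∃ K : X →L[𝕜] X, IsCompactOperator K ∧ ∀ e : X, ‖e‖ ≤ 1 →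
      ∀ h : StrongDual 𝕜 X, ‖h‖ ≤ 1 → n * ‖h - h.comp K + h e • f‖ ≤ 1 + ε := by
    intro ε hε
    obtain ⟨K, hK, hKn⟩ := exists_isCompactOperator_norm_le_of_isMIdeal_withLp hM hf hε
    refine ⟨K, hK, fun e he h hh => ?_⟩
    have hcomp : h - h.comp K + h e • f = h.comp (.id 𝕜 X - K + f.smulRight e) := by
      ext x
      simp [mul_comm]
    rw [hcomp]
    refine (mul_le_mul_of_nonneg_left ?_ hn.le).trans (hKn e he)
    exact (h.opNorm_comp_le _).trans (mul_le_of_le_one_left (norm_nonneg _) hh)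
  refine le_min ?_ ?_
  · rw [le_div_iff₀ two_pos]
    refine le_one_add_ausModulus hu fun Y hY ε hε => ?_
    -- If both `‖u ± y‖` were below `2 n - ε`, the errors of order `η` below would give `ε < 5 n η`.
    set η := ε / (5 * n) with hη
    have hη0 : 0 < η := by positivity
    obtain ⟨K, hK, hKn⟩ := key η hη0
    obtain ⟨y, hyY, hy, hKy⟩ := hK.exists_mem_finCodim_norm_apply_le hdim hY hη0
    obtain ⟨h, hh, hhy⟩ := exists_dual_vector'' 𝕜 y
    rw [hy, RCLike.ofReal_one] at hhy
    by_contra! hcon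
    have hp := hcon y hyY hy.le
    have hm := hcon (-y) (Y.neg_mem hyY) (by rw [norm_neg]; exact hy.le)
    rw [← sub_eq_add_neg] at hm
    have h1 := hKn y hy.le h hh
    have h2 := hKn (-y) (by rw [norm_neg]; exact hy.le) h hh
    rw [hhy] at h1
    rw [map_neg, hhy] at h2
    have h1' : f + (h - h.comp K) = h - h.comp K + (1 : 𝕜) • f := by module
    have h2' : f - (h - h.comp K) = -(h - h.comp K + (-1 : 𝕜) • f) := by module
    rw [← h1'] at h1
    rw [← norm_neg, ← h2'] at h2
    have h3 := two_mul_norm_apply_add_apply_le f (h - h.comp K) u y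
    have h4 : 2 - η ≤ ‖f u + (h - h.comp K) y‖ := by
      have e : f u + (h - h.comp K) y = 2 - h (K y) := by
        rw [hfu, sub_apply, hhy, ContinuousLinearMap.comp_apply]
        ring
      have h5 := norm_sub_norm_le (2 : 𝕜) (h (K y))
      rw [← e, RCLike.norm_ofNat] at h5
      have h6 := h.le_of_opNorm_le hh (K y)
      linarith
    have h6 := mul_le_mul_of_nonneg_left h3 hn.le
    have hm0 : 0 ≤ n * 2 - ε := (norm_nonneg _).trans hp.le
    have h7 : n * ‖f + (h - h.comp K)‖ * ‖u + y‖ ≤ (1 + η) * (n * 2 - ε) :=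
      mul_le_mul h1 hp.le (norm_nonneg _) (by positivity)
    have h8 : n * ‖f - (h - h.comp K)‖ * ‖u - y‖ ≤ (1 + η) * (n * 2 - ε) :=
      mul_le_mul h2 hm.le (norm_nonneg _) (by positivity)
    have h9 : n * (2 - η) ≤ n * ‖f u + (h - h.comp K) y‖ :=
      mul_le_mul_of_nonneg_left h4 hn.le
    have h10 : ε = 5 * n * η := by rw [hη]; field_simp
    nlinarith [mul_pos hε hη0, mul_pos hn hη0]
  · have hdim' := not_finiteDimensional_strongDual hdim
    have hδ := aucModulus_one_nonneg hdim'
    rw [le_one_div hn (by linarith)]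
    refine one_add_aucModulus_le hdim' hf fun Y hY ε hε => ?_
    -- The tolerance `η` solves `(1 + η) / n + 2 η = 1 / n + ε`.
    set η := ε * n / (1 + 2 * n) with hη
    have hη0 : 0 < η := by positivity
    obtain ⟨K, hK, hKn⟩ := key η hη0
    obtain ⟨h, hhY, hh, hhK⟩ := hK.exists_mem_finCodim_norm_comp_le hdim hY hη0
    obtain ⟨e, r, he, hr, hre, her⟩ := exists_apply_eq_ofReal hh hη0
    refine ⟨h, hhY, hh, ?_⟩
    have h1 := hKn e he h hh.le
    rw [her] at h1
    have h2 : ‖f + h‖ ≤ ‖h - h.comp K + (r : 𝕜) • f‖ + ‖h.comp K‖ + ‖((1 - r : ℝ) : 𝕜) • f‖ := by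
      refine le_trans (le_of_eq ?_) (norm_add₃_le (a := h - h.comp K + (r : 𝕜) • f))
      rw [RCLike.ofReal_sub, RCLike.ofReal_one]
      congr 1
      module
    rw [norm_smul, hf, mul_one, RCLike.norm_ofReal, abs_of_nonneg (by linarith)] at h2
    have h3 : ‖h - h.comp K + (r : 𝕜) • f‖ ≤ (1 + η) / n := by
      rwa [le_div_iff₀ hn, mul_comm]
    have h4 : (1 + η) / n + 2 * η = 1 / n + ε := by
      rw [hη]
      field_simp
      ring
    linarith

theorem mainTheorem8 {𝕜 X : Type*} [RCLike 𝕜] [NormedAddCommGroup X] [NormedSpace 𝕜 X]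
    [CompleteSpace X] (hdim : ¬ FiniteDimensional 𝕜 X) (hn : 0 < numericalIndex 𝕜 X) :
    (IsMIdeal (numRadCompact 𝕜 (X × X)) →
      numericalIndex 𝕜 X ≤
        min (1 / (1 + aucModulus 𝕜 X 1)) ((1 + ausModulus 𝕜 (StrongDual 𝕜 X) 1) / 2)) ∧
    (IsMIdeal (numRadCompact 𝕜 (WithLp 1 (X × X))) →
      numericalIndex 𝕜 X ≤
        min ((1 + ausModulus 𝕜 X 1) / 2) (1 / (1 + aucModulus 𝕜 (StrongDual 𝕜 X) 1))) :=
  ⟨numericalIndex_le_of_isMIdeal_prod hdim hn, numericalIndex_le_of_isMIdeal_withLp hdim hn⟩
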